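/- Let $X=(X,d,\mu)$ be a metric space with a complete Borel measure $\mu$ (defined on the completion of the Borel $\sigma$-algebra) such that $0<\mu(B)<\infty$ for every ball; balls $B(x,r)=\{y:d(x,y)<r\}$, $r>0$, are open. Let $1\le p<\infty$. Assume that $\mu$ is doubling, i.e. $\mu(B(y,2r))\le C\mu(B(y,r))$ for all $y\in X$, $r>0$, and supports a $p$-Poincaré inequality, i.e. there are $C>0$, $\lambda\ge1$ such that for all balls $B=B(y,r)$, all integrable $f:X\to[-\infty,\infty]$ and all upper gradients $g$ of $f$, $$\frac1{\mu(B)}\int_B|f-f_B|\,d\mu\le Cr\Bigl(\frac1{\mu(\lambda B)}\int_{\lambda B}g^p\,d\mu\Bigr)^{1/p},\qquad f_B=\frac1{\mu(B)}\int_B f\,d\mu .$$ Here a Borel function $g:X\to[0,\infty]$ is an upper gradient of $f$ if $|f(\gamma(0))-f(\gamma(l))|\le\int_\gamma g\,ds$ for every nonconstant compact rectifiable curve $\gamma:[0,l]\to X$ parametrized by arc length (the left-hand side being $\infty$ if one of its terms is infinite); a measurable $g$ is a $p$-weak upper gradient of $f$ if this holds for all curves outside a family $\Gamma$ for which there is a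 Borel $\rho\ge0$, $\rho\in L^p(X)$, with $\int_\gamma\rho\,ds=\infty$ for all $\gamma\in\Gamma$. The Newtonian space $N^{1,p}(X)$ consists of the everywhere defined measurable functions in $L^p(X)$ that have an upper gradient in $L^p(X)$. For $\Omega$ open and $E\subset\Omega$, $$\mathrm{cap}_p(E,\Omega)=\inf_u\int_\Omega g_u^p\,d\mu,$$ where the infimum is over all $u\in N^{1,p}(X)$ with $u=0$ on $X\setminus\Omega$ and $u\ge1$ on $E$, and $g_u$ is the minimal $p$-weak upper gradient of $u$, i.e. the a.e. smallest of the $p$-weak upper gradients of $u$ in $L^p(X)$. Fix $x\in X$, write $B_r=B(x,r)$, and let \begin{align*} \underline{Q}_0&=\Bigl\{q>0:\exists\,C_q>0:\ \frac{\mu(B_r)}{\mu(B_R)}\le C_q\Bigl(\frac rR\Bigr)^q\text{ for }0<r<R\le1\Bigr\},\\ \overline{Q}_0&=\Bigl\{q>0:\exists\,C_q>0:\ \frac{\mu(B_r)}{\mu(B_R)}\ge C_q\Bigl(\frac rR\Bigr)^q\text{ for }0<r<R\le1\Bigr\}. \end{align*} Let $0<R_0<\tfrac14\operatorname{diam}X$.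 Consider the estimates $$(1)\quad \mathrm{cap}_p(B_r,B_R)\simeq\frac{\mu(B_r)}{r^p}\ \text{ whenever } 0<2r\le R\le R_0,\qquad (2)\quad \mathrm{cap}_p(B_r,B_R)\simeq\frac{\mu(B_R)}{R^p}\ \text{ whenever } 0<2r\le R\le R_0,$$ where $a\simeq b$ means $C^{-1}b\le a\le Cb$ with a constant $C>0$ independent of $r$ and $R$ (it may depend on $R_0$). If $p$ lies in the interior of $\underline{Q}_0$, then (1) holds. If $p$ lies in the interior of $\overline{Q}_0$, then (2) holds. Conversely, if (1) holds, then $p\in\underline{Q}_0$, and if (2) holds, then $p\in\overline{Q}_0$. -/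

import Mathlib

open MeasureTheory Metric Set
open scoped ENNReal

/-- `IsArcCurve l γ`: the restriction of `γ` to `[0, l]` is a nonconstant (i.e. `0 < l`) compact
rectifiable curve in `X`, of length `l`, parametrized by arc length. -/
def IsArcCurve {X : Type*} [MetricSpace X] (l : ℝ) (γ : ℝ → X) : Prop :=
  0 < l ∧ HasUnitSpeedOn γ (Icc 0 l)

/-- The line integral `∫_γ g ds` of a nonnegative function along an arc-length parametrized
curve of length `l`. -/
noncomputable def arcIntegral {X : Type*} (l : ℝ) (γ : ℝ → X) (g : X → ℝ≥0∞) : ℝ≥0∞ :=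
  ∫⁻ t in Icc 0 l, g (γ t)

/-- The Borel function `g : X → [0, ∞]` is an upper gradient of `f : X → [-∞, ∞]`.
With the conventions of `EReal`, the quantity `(a - b).abs` is `|a - b|` for finite `a`, `b`, and
is `∞` as soon as `a` or `b` is infinite (see `EReal_abs_sub_eq_top`). -/
def IsUpperGradient {X : Type*} [MetricSpace X] [MeasurableSpace X]
    (g : X → ℝ≥0∞) (f : X → EReal) : Prop :=
  Measurable g ∧
    ∀ (l : ℝ) (γ : ℝ → X), IsArcCurve l γ → (f (γ 0) - f (γ l)).abs ≤ arcIntegral l γ g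

theorem EReal_abs_sub_eq_top {a b : EReal} (h : a = ⊤ ∨ a = ⊥ ∨ b = ⊤ ∨ b = ⊥) :
    (a - b).abs = ⊤ := by
  rcases h with rfl | rfl | rfl | rfl
  · induction b <;> simp [sub_eq_add_neg]
  · simp [sub_eq_add_neg]
  · simp [sub_eq_add_neg]
  · induction a <;> simp [sub_eq_add_neg]

/-- The property `P` of curves holds for `p`-almost every curve: there is a Borel function
`ρ ≥ 0` in `L^p(X)` such that `∫_γ ρ ds = ∞` for each curve `γ` for which `P` fails. -/
def ForPAlmostEveryCurve {X : Type*} [MetricSpace X] [MeasurableSpace X] (p : ℝ) (μ : Measure X)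
    (P : ℝ → (ℝ → X) → Prop) : Prop :=
  ∃ ρ : X → ℝ≥0∞, Measurable ρ ∧ ∫⁻ y, ρ y ^ p ∂μ < ∞ ∧
    ∀ (l : ℝ) (γ : ℝ → X), IsArcCurve l γ → ¬ P l γ → arcIntegral l γ ρ = ∞

/-- The function `g : X → [0, ∞]`, measurable with respect to the completion of `μ`, is a
`p`-weak upper gradient of `f : X → [-∞, ∞]`. -/
def IsWeakUpperGradient {X : Type*} [MetricSpace X] [MeasurableSpace X] (p : ℝ) (μ : Measure X)
    (g : X → ℝ≥0∞) (f : X → EReal) : Prop :=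
  AEMeasurable g μ ∧
    ForPAlmostEveryCurve p μ fun l γ => (f (γ 0) - f (γ l)).abs ≤ arcIntegral l γ g

/-- The Newtonian norm `(∫ |f|^p dμ + inf_g ∫ g^p dμ)^{1/p}`, with the infimum over all upper
gradients `g` of `f`. -/
noncomputable def newtonianNorm {X : Type*} [MetricSpace X] [MeasurableSpace X] (p : ℝ)
    (μ : Measure X) (f : X → EReal) : ℝ≥0∞ :=
  (∫⁻ y, (f y).abs ^ p ∂μ +
    ⨅ (g : X → ℝ≥0∞) (_ : IsUpperGradient g f), ∫⁻ y, g y ^ p ∂μ) ^ (1 / p)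

/-- `f` belongs to the Newtonian space `N^{1,p}(X)`; functions are defined everywhere, and
measurable with respect to the completion of `μ`. -/
def MemNewtonian {X : Type*} [MetricSpace X] [MeasurableSpace X] (p : ℝ) (μ : Measure X)
    (f : X → EReal) : Prop :=
  AEMeasurable f μ ∧ newtonianNorm p μ f < ∞

/-- `u` belongs to `N^{1,p}_0(Ω)`, where `u` is thought of as extended by zero outside `Ω`. -/
def MemNewtonianZero {X : Type*} [MetricSpace X] [MeasurableSpace X] (p : ℝ) (μ : Measure X)
    (Ω : Set X) (u : X → EReal) : Prop :=
  MemNewtonian p μ u ∧ ∀ y, y ∉ Ω → u y = 0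

/-- The energy `∫_Ω g_u^p dμ` of `u`, where `g_u` is the minimal `p`-weak upper gradient of `u`.
As `g_u` is, up to null sets, the smallest of the `p`-weak upper gradients of `u` in `L^p(X)`,
the energy is the (attained) infimum of `∫_Ω g^p dμ` over these. -/
noncomputable def pEnergy {X : Type*} [MetricSpace X] [MeasurableSpace X] (p : ℝ)
    (μ : Measure X) (Ω : Set X) (u : X → EReal) : ℝ≥0∞ :=
  ⨅ (g : X → ℝ≥0∞) (_ : IsWeakUpperGradient p μ g u) (_ : ∫⁻ y, g y ^ p ∂μ < ∞),
    ∫⁻ y in Ω, g y ^ p ∂μ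

/-- The variational `p`-capacity `cap_p(E, Ω)` of `E ⊆ Ω` with respect to the open set `Ω`. -/
noncomputable def variationalCapacity {X : Type*} [MetricSpace X] [MeasurableSpace X] (p : ℝ)
    (μ : Measure X) (E Ω : Set X) : ℝ≥0∞ :=
  ⨅ (u : X → EReal) (_ : MemNewtonianZero p μ Ω u) (_ : ∀ y ∈ E, 1 ≤ u y), pEnergy p μ Ω u

/-- `μ` is (globally) doubling. -/
def IsGloballyDoubling {X : Type*} [MetricSpace X] [MeasurableSpace X] (μ : Measure X) : Prop :=
  ∃ C : ℝ, 0 < C ∧ ∀ (x : X) (r : ℝ), 0 < r →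
    μ (ball x (2 * r)) ≤ ENNReal.ofReal C * μ (ball x r)

/-- `μ` supports a (global) `p`-Poincaré inequality. Here `f : X → [-∞, ∞]` is integrable on `X`,
hence finite almost everywhere, so that `EReal.toReal` does not affect the integrals. -/
def SupportsPoincare {X : Type*} [MetricSpace X] [MeasurableSpace X] (p : ℝ)
    (μ : Measure X) : Prop :=
  ∃ C Λ : ℝ, 0 < C ∧ 1 ≤ Λ ∧ ∀ (x : X) (r : ℝ), 0 < r →
    ∀ (f : X → EReal) (g : X → ℝ≥0∞), AEMeasurable f μ → ∫⁻ y, (f y).abs ∂μ < ∞ →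
      IsUpperGradient g f →
        ⨍⁻ y in ball x r, ENNReal.ofReal |(f y).toReal - ⨍ z in ball x r, (f z).toReal ∂μ| ∂μ ≤
          ENNReal.ofReal (C * r) * (⨍⁻ y in ball x (Λ * r), g y ^ p ∂μ) ^ (1 / p)

/-- The exponent set `\underline{Q}_0(x)`. -/
def lowerQZero {X : Type*} [MetricSpace X] [MeasurableSpace X] (μ : Measure X) (x : X) : Set ℝ :=
  {q | 0 < q ∧ ∃ C : ℝ, 0 < C ∧ ∀ r R : ℝ, 0 < r → r < R → R ≤ 1 →
    μ.real (ball x r) / μ.real (ball x R) ≤ C * (r / R) ^ q}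

/-- The exponent set `\overline{Q}_0(x)`. -/
def upperQZero {X : Type*} [MetricSpace X] [MeasurableSpace X] (μ : Measure X) (x : X) : Set ℝ :=
  {q | 0 < q ∧ ∃ C : ℝ, 0 < C ∧ ∀ r R : ℝ, 0 < r → r < R → R ≤ 1 →
    C * (r / R) ^ q ≤ μ.real (ball x r) / μ.real (ball x R)}

/-- `cap_p(B_r, B_R) ≃ F r R` whenever `0 < 2r ≤ R ≤ R₀`, with balls centred at `x` and a
comparison constant that does not depend on `r` and `R`. -/
def CapacityComparable {X : Type*} [MetricSpace X] [MeasurableSpace X] (p : ℝ) (μ : Measure X)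
    (x : X) (R₀ : ℝ) (F : ℝ → ℝ → ℝ≥0∞) : Prop :=
  ∃ C : ℝ, 0 < C ∧ ∀ r R : ℝ, 0 < r → 2 * r ≤ R → R ≤ R₀ →
    variationalCapacity p μ (ball x r) (ball x R) ≤ ENNReal.ofReal C * F r R ∧
      F r R ≤ ENNReal.ofReal C * variationalCapacity p μ (ball x r) (ball x R)

/-! ### Arc-length curves, and cutting off an upper gradient outside an open set. -/

section Curves

variable {X : Type*} [MetricSpace X]

/-! Upper bounds for the capacity hold without any assumption on `p`. The function equal to 1 on B_s
and falling linearly to 0 across B_{2s} has upper gradient 1/s on B_{2s}, so cap(B_r, B_R) ≤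
μ(B_{2s})/s^p for r ≤ s ≤ R/2 (`variationalCapacity_ball_le`). The choice s = r, with doubling,
gives the bound in (1), and s = R/2 gives the bound in (2). The converse directions follow: the
lower estimate in (1) combined with the upper bound from (2) eliminates the capacity and leaves
μ(B_r)/r^p ≲ μ(B_R)/R^p, which is the defining inequality for p ∈ `lowerQZero`. Exchanging the roles
of (1) and (2) gives `upperQZero`.

For the lower bounds, let v be admissible with values in [0, 1] and let E be the energy of an upper
gradient of v. The average of v over B_r is 1. Over a dyadic ball of radius between 4R and 8R it is
at most 1 - c, because that ball contains a fixed proportion of points outside B_R. Telescoping over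
the radii s_j = 2^{j+1} r and applying Poincaré on each ball gives c ≲ E^{1/p} Σ_j
(s_j^p/μ(B_{s_j}))^{1/p} (`PoincareInequality.inv_le_sum`).

That p is interior provides an admissible exponent q strictly on one side of p, so s^p/μ(B_s) is
controlled by a geometric progression along the dyadic radii. If q > p in `lowerQZero`, the smallest
radius dominates the sum and E ≳ μ(B_r)/r^p. If q < p in `upperQZero`, the largest one dominates and
E ≳ μ(B_R)/R^p.

Weak upper gradients and extended values are removed beforehand, at the cost of a factor 2^p
(`le_variationalCapacity`). -/

theorem IsArcCurve.edist_le {l : ℝ} {γ : ℝ → X} (h : IsArcCurve l γ) {a b : ℝ} (ha : 0 ≤ a)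
    (hab : a ≤ b) (hb : b ≤ l) : edist (γ a) (γ b) ≤ ENNReal.ofReal (b - a) := by
  have ha' : a ∈ Icc 0 l := ⟨ha, hab.trans hb⟩
  have hb' : b ∈ Icc 0 l := ⟨ha.trans hab, hb⟩
  have h1 := h.2 ha' hb'
  have h2 := eVariationOn.edist_le γ (s := Icc 0 l ∩ Icc a b) (x := a) (y := b)
    ⟨ha', left_mem_Icc.2 hab⟩ ⟨hb', right_mem_Icc.2 hab⟩
  rw [h1] at h2
  simpa using h2

theorem IsArcCurve.dist_le {l : ℝ} {γ : ℝ → X} (h : IsArcCurve l γ) {a b : ℝ} (ha : 0 ≤ a)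
    (hab : a ≤ b) (hb : b ≤ l) : dist (γ a) (γ b) ≤ b - a := by
  have := h.edist_le ha hab hb
  rw [edist_dist] at this
  exact (ENNReal.ofReal_le_ofReal_iff (sub_nonneg.2 hab)).1 this

theorem IsArcCurve.continuousOn {l : ℝ} {γ : ℝ → X} (h : IsArcCurve l γ) :
    ContinuousOn γ (Icc 0 l) := by
  refine LipschitzOnWith.continuousOn (K := 1) (LipschitzOnWith.of_dist_le_mul fun a ha b hb => ?_)
  rcases le_total a b with hab | hab
  · have := h.dist_le ha.1 hab hb.2
    rw [Real.dist_eq, abs_sub_comm, abs_of_nonneg (sub_nonneg.2 hab)]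
    simpa using this
  · have := h.dist_le hb.1 hab ha.2
    rw [Real.dist_eq, abs_of_nonneg (sub_nonneg.2 hab), dist_comm]
    simpa using this

theorem IsArcCurve.subcurve {l : ℝ} {γ : ℝ → X} (h : IsArcCurve l γ) {a b : ℝ} (ha : 0 ≤ a)
    (hab : a < b) (hb : b ≤ l) : IsArcCurve (b - a) fun t => γ (a + t) := by
  refine ⟨sub_pos.2 hab, fun s hs t ht => ?_⟩
  have h1 := eVariationOn.comp_eq_of_monotoneOn γ (t := Icc 0 (b - a) ∩ Icc s t) (fun t => a + t)
    (fun _ _ _ _ h => by simpa using h)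
  have h2 := h.2 (x := a + s) ⟨by linarith [hs.1], by linarith [hs.2]⟩ (y := a + t)
    ⟨by linarith [ht.1], by linarith [ht.2]⟩
  have e1 : Icc 0 (b - a) ∩ Icc s t = Icc s t :=
    inter_eq_right.2 (Icc_subset_Icc hs.1 ht.2)
  have e2 : Icc 0 l ∩ Icc (a + s) (a + t) = Icc (a + s) (a + t) :=
    inter_eq_right.2 (Icc_subset_Icc (by linarith [hs.1]) (by linarith [ht.2]))
  rw [e1, image_const_add_Icc] at h1
  rw [e2] at h2
  rw [e1]
  refine (h1.trans h2).trans ?_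
  congr 2
  ring

theorem arcIntegral_subcurve {X : Type*} (γ : ℝ → X) (g : X → ℝ≥0∞) (a b : ℝ) :
    arcIntegral (b - a) (fun t => γ (a + t)) g = ∫⁻ t in Icc a b, g (γ t) := by
  have := (measurePreserving_add_left volume a).setLIntegral_comp_preimage_emb
    (measurableEmbedding_addLeft a) (fun t => g (γ t)) (Icc a b)
  rw [← this, arcIntegral]
  simp

/-- If the upper gradient inequality for a nonnegative function that vanishes outside an open set
holds along all subcurves, then the gradient may be cut off outside that set. -/
theorem IsArcCurve.abs_sub_le_indicator {l : ℝ} {γ : ℝ → X} (h : IsArcCurve l γ) {Ω : Set X}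
    (hΩ : IsOpen Ω) {v : X → ℝ} (hv : ∀ y, 0 ≤ v y) (hvΩ : ∀ y, y ∉ Ω → v y = 0) {g : X → ℝ≥0∞}
    (hg : ∀ a b, 0 ≤ a → a < b → b ≤ l →
      ENNReal.ofReal |v (γ a) - v (γ b)| ≤ ∫⁻ t in Icc a b, g (γ t)) :
    ENNReal.ofReal |v (γ 0) - v (γ l)| ≤ arcIntegral l γ (Ω.indicator g) := by
  -- K is the set of times spent outside Ω. If it is nonempty, v vanishes at its first and last
  -- times, so the part of the curve before the first bounds v(γ 0) and the part after the last
  -- bounds v(γ l). Since v ≥ 0, the difference is at most the larger of the two.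
  set K : Set ℝ := Icc 0 l ∩ γ ⁻¹' Ωᶜ with hK
  have hKc : IsCompact K := by
    have : IsClosed K := h.continuousOn.preimage_isClosed_of_isClosed isClosed_Icc hΩ.isClosed_compl
    exact isCompact_Icc.of_isClosed_subset this inter_subset_left
  have key : ∀ s : Set ℝ, MeasurableSet s → s ⊆ Icc 0 l → (∀ t ∈ s, t ∉ K) →
      ∫⁻ t in s, g (γ t) ≤ arcIntegral l γ (Ω.indicator g) := by
    intro s hs hsl hsK
    have : ∫⁻ t in s, g (γ t) = ∫⁻ t in s, Ω.indicator g (γ t) := by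
      refine setLIntegral_congr_fun hs fun t ht => ?_
      have : γ t ∈ Ω := by
        by_contra hc
        exact hsK t ht ⟨hsl ht, hc⟩
      simp [this]
    rw [this]
    exact lintegral_mono_set hsl
  rcases K.eq_empty_or_nonempty with hKe | hKn
  · exact (hg 0 l le_rfl h.1 le_rfl).trans
      (key _ measurableSet_Icc subset_rfl fun t _ ht => by simp [hKe] at ht)
  have h0 : ENNReal.ofReal (v (γ 0)) ≤ arcIntegral l γ (Ω.indicator g) := by
    have hm := hKc.sInf_mem hKn
    have hlow : ∀ t ∈ K, sInf K ≤ t := fun t ht => csInf_le hKc.bddBelow ht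
    have hz : v (γ (sInf K)) = 0 := hvΩ _ hm.2
    rcases hm.1.1.eq_or_lt with h' | h'
    · rw [h', hz]; simp
    · have := hg 0 (sInf K) le_rfl h' hm.1.2
      rw [hz, sub_zero, abs_of_nonneg (hv _)] at this
      -- The endpoint lies outside Ω and is dropped as a null set of times.
      rw [setLIntegral_congr Ico_ae_eq_Icc.symm] at this
      exact this.trans (key _ measurableSet_Ico
        (fun t ht => ⟨ht.1, ht.2.le.trans hm.1.2⟩) fun t ht htK => (hlow t htK).not_gt ht.2)
  have hl : ENNReal.ofReal (v (γ l)) ≤ arcIntegral l γ (Ω.indicator g) := by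
    have hm := hKc.sSup_mem hKn
    have hup : ∀ t ∈ K, t ≤ sSup K := fun t ht => le_csSup hKc.bddAbove ht
    have hz : v (γ (sSup K)) = 0 := hvΩ _ hm.2
    rcases hm.1.2.eq_or_lt with h' | h'
    · rw [← h', hz]; simp
    · have := hg (sSup K) l hm.1.1 h' le_rfl
      rw [hz, zero_sub, abs_neg, abs_of_nonneg (hv _)] at this
      rw [setLIntegral_congr Ioc_ae_eq_Icc.symm] at this
      exact this.trans (key _ measurableSet_Ioc
        (fun t ht => ⟨hm.1.1.trans ht.1.le, ht.2⟩) fun t ht htK => (hup t htK).not_gt ht.1)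
  rcases le_total (v (γ 0)) (v (γ l)) with hle | hle
  · refine (ENNReal.ofReal_le_ofReal ?_).trans hl
    rw [abs_le]; constructor <;> linarith [hv (γ 0), hv (γ l)]
  · refine (ENNReal.ofReal_le_ofReal ?_).trans h0
    rw [abs_le]; constructor <;> linarith [hv (γ 0), hv (γ l)]

theorem EReal.abs_coe_sub_coe (a b : ℝ) :
    ((a : EReal) - (b : EReal)).abs = ENNReal.ofReal |a - b| := by
  rw [← EReal.coe_sub, EReal.abs_def]

end Curves

/-! ### Truncation to the unit interval. -/

section Clamp

/-- The truncation of an extended real number to the interval `[0, 1]`. -/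
noncomputable def unitClamp (a : EReal) : ℝ := (max 0 (min 1 a)).toReal

theorem unitClamp_coe (a : ℝ) : unitClamp a = max 0 (min 1 a) := by
  have hm := EReal.coe_strictMono.monotone
  rw [unitClamp, ← EReal.coe_zero, ← EReal.coe_one, ← hm.map_min, ← hm.map_max, EReal.toReal_coe]

theorem unitClamp_nonneg (a : EReal) : 0 ≤ unitClamp a :=
  EReal.toReal_nonneg (le_max_left _ _)

theorem unitClamp_le_one (a : EReal) : unitClamp a ≤ 1 := by
  have h : max 0 (min 1 a) ≤ 1 := max_le zero_le_one (min_le_left _ _)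
  have := EReal.toReal_le_toReal h (ne_of_gt (lt_of_lt_of_le EReal.bot_lt_zero (le_max_left _ _)))
    (EReal.coe_ne_top 1)
  rwa [EReal.toReal_one] at this

theorem unitClamp_of_one_le {a : EReal} (h : 1 ≤ a) : unitClamp a = 1 := by
  simp [unitClamp, min_eq_left h]

theorem unitClamp_zero : unitClamp 0 = 0 := by
  simp [unitClamp]

theorem measurable_unitClamp : Measurable unitClamp := by
  unfold unitClamp
  exact measurable_ereal_toReal.comp
    (measurable_const.max (measurable_const.min measurable_id))

theorem abs_unitClamp_sub_le (a b : EReal) :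
    ENNReal.ofReal |unitClamp a - unitClamp b| ≤ (a - b).abs := by
  by_cases h : a = ⊤ ∨ a = ⊥ ∨ b = ⊤ ∨ b = ⊥
  · rw [EReal_abs_sub_eq_top h]; exact le_top
  push Not at h
  lift a to ℝ using ⟨h.1, h.2.1⟩
  lift b to ℝ using ⟨h.2.2.1, h.2.2.2⟩
  rw [EReal.abs_coe_sub_coe, unitClamp_coe, unitClamp_coe]
  refine ENNReal.ofReal_le_ofReal ((abs_max_sub_max_le_max _ _ _ _).trans ?_)
  refine max_le (by simp) ((abs_min_sub_min_le_max _ _ _ _).trans (max_le (by simp) le_rfl))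

end Clamp

/-! ### From weak to genuine upper gradients, and the upper bound for the capacity. -/

section Capacity

variable {X : Type*} [MetricSpace X] [MeasurableSpace X]

/-- Take a Borel majorant of g that equals g almost everywhere, cut it off outside Ω, and add ερ,
where ρ has infinite integral along every exceptional curve. The correction ερ costs at most δ once
ε is small, and the factor 2^p comes from (a + b)^p ≤ 2^p (a^p + b^p). -/
theorem IsWeakUpperGradient.exists_isUpperGradient_unitClamp [BorelSpace X] {μ : Measure X} {p : ℝ}
    (hp : 1 ≤ p) {Ω : Set X} (hΩ : IsOpen Ω) {u : X → EReal} (hu : ∀ y, y ∉ Ω → u y = 0)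
    {g : X → ℝ≥0∞} (hg : IsWeakUpperGradient p μ g u) {δ : ℝ≥0∞} (hδ : δ ≠ 0) :
    ∃ G : X → ℝ≥0∞, IsUpperGradient G (fun y => (unitClamp (u y) : EReal)) ∧
      ∫⁻ y, G y ^ p ∂μ ≤ 2 ^ p * ∫⁻ y in Ω, g y ^ p ∂μ + δ := by
  obtain ⟨hgm, ρ, hρm, hρ, hρc⟩ := hg
  have hp0 : 0 < p := by linarith
  set N : Set X := toMeasurable μ {y | g y ≠ hgm.mk g y} with hN
  have hN0 : μ N = 0 := by
    rw [hN, measure_toMeasurable]; exact hgm.ae_eq_mk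
  have hNm : MeasurableSet N := measurableSet_toMeasurable _ _
  -- Line integrals can see μ-null sets, so an almost everywhere equal representative is not enough.
  -- The value ∞ on N makes g' ≥ g at every point.
  set g' : X → ℝ≥0∞ := hgm.mk g + N.indicator (fun _ => ∞) with hg'
  have hg'm : Measurable g' := hgm.measurable_mk.add (measurable_const.indicator hNm)
  have hle : ∀ y, g y ≤ g' y := by
    intro y
    by_cases hy : y ∈ N
    · simp [hg', hy]
    · have : g y = hgm.mk g y := by
        by_contra hc
        exact hy (subset_toMeasurable _ _ hc)
      simp [hg', hy, this]
  have hae : g' =ᵐ[μ] g := by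
    have : ∀ᵐ y ∂μ, y ∉ N := measure_eq_zero_iff_ae_notMem.1 hN0
    filter_upwards [hgm.ae_eq_mk, this] with y h1 h2
    simp [hg', h2, h1]
  set M : ℝ≥0∞ := 2 ^ p * ∫⁻ y, ρ y ^ p ∂μ with hM
  have hMtop : M ≠ ∞ := ENNReal.mul_ne_top (by simp) hρ.ne
  -- Chosen so that ε^p M ≤ δ. The summand 1 covers M = 0.
  set ε : ℝ≥0∞ := (δ / (M + 1)) ^ (1 / p) with hε
  have hεp : ε ^ p = δ / (M + 1) := by
    rw [hε, ← ENNReal.rpow_mul, one_div_mul_cancel hp0.ne', ENNReal.rpow_one]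
  have hε0 : ε ≠ 0 := by
    intro h0
    rw [h0, ENNReal.zero_rpow_of_pos hp0] at hεp
    rcases ENNReal.div_eq_zero_iff.1 hεp.symm with h | h
    · exact hδ h
    · exact (ENNReal.add_ne_top.2 ⟨hMtop, ENNReal.one_ne_top⟩) h
  refine ⟨Ω.indicator g' + fun y => ε * ρ y, ⟨(hg'm.indicator hΩ.measurableSet).add
    (hρm.const_mul _), fun l γ hγ => ?_⟩, ?_⟩
  · rw [EReal.abs_coe_sub_coe]
    by_cases hbad : arcIntegral l γ ρ = ∞
    · have h1 : ε * arcIntegral l γ ρ ≤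
          arcIntegral l γ (Ω.indicator g' + fun y => ε * ρ y) :=
        (lintegral_const_mul_le _ _).trans (lintegral_mono fun t => le_add_self)
      rw [hbad, ENNReal.mul_top hε0, top_le_iff] at h1
      rw [h1]; exact le_top
    refine (hγ.abs_sub_le_indicator hΩ (v := fun y => unitClamp (u y)) (g := g')
      (fun y => unitClamp_nonneg _) (fun y hy => by rw [hu y hy, unitClamp_zero]) ?_).trans
      (lintegral_mono fun t => le_self_add)
    intro a b ha hab hb
    refine (abs_unitClamp_sub_le _ _).trans ?_
    -- If the inequality failed on a subcurve, ρ would have infinite integral along it, hence along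
    -- the whole curve, which `hbad` excludes.
    by_contra hc
    have h2 := hρc _ _ (hγ.subcurve ha hab hb) (by
      intro hgood
      refine hc ?_
      rw [arcIntegral_subcurve] at hgood
      simp only [add_zero, add_sub_cancel] at hgood
      exact hgood.trans (lintegral_mono fun t => hle _))
    rw [arcIntegral_subcurve] at h2
    exact hbad (top_le_iff.1 (h2 ▸ lintegral_mono_set (Icc_subset_Icc ha hb)))
  · calc ∫⁻ y, (Ω.indicator g' + fun y => ε * ρ y) y ^ p ∂μ
        ≤ ∫⁻ y, 2 ^ p * (Ω.indicator (fun y => g' y ^ p) y + ε ^ p * ρ y ^ p) ∂μ := by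
          refine lintegral_mono fun y => ?_
          refine (ENNReal.rpow_add_le_mul_rpow_add_rpow _ _ hp).trans ?_
          refine mul_le_mul' (ENNReal.rpow_le_rpow_of_exponent_le (by norm_num) (by linarith)) ?_
          rw [ENNReal.mul_rpow_of_nonneg _ _ hp0.le]
          refine add_le_add (le_of_eq ?_) le_rfl
          by_cases hy : y ∈ Ω <;> simp [hy, hp0]
      _ = 2 ^ p * ∫⁻ y in Ω, g y ^ p ∂μ + ε ^ p * M := by
          have hm1 : Measurable (Ω.indicator fun y => g' y ^ p) :=
            (hg'm.pow_const p).indicator hΩ.measurableSet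
          have hm2 : Measurable fun y => Ω.indicator (fun y => g' y ^ p) y + ε ^ p * ρ y ^ p :=
            hm1.add ((hρm.pow_const p).const_mul _)
          rw [lintegral_const_mul _ hm2, lintegral_add_left hm1, lintegral_const_mul _ (hρm.pow_const p),
            lintegral_indicator hΩ.measurableSet, mul_add, hM]
          congr 1
          · congr 1
            exact lintegral_congr_ae (ae_restrict_of_ae (hae.mono fun y hy => by
              simp only [hy]))
          · ring
      _ ≤ 2 ^ p * ∫⁻ y in Ω, g y ^ p ∂μ + δ := by
          refine add_le_add le_rfl ?_
          rw [hεp]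
          calc δ / (M + 1) * M ≤ δ / (M + 1) * (M + 1) := mul_le_mul' le_rfl le_self_add
            _ = δ := ENNReal.div_mul_cancel (by simp) (ENNReal.add_ne_top.2 ⟨hMtop, by simp⟩)

/-- The variational capacity is bounded from below by the energies of the genuine upper gradients
of admissible functions with values in `[0, 1]`. -/
theorem le_variationalCapacity [BorelSpace X] {μ : Measure X} {p : ℝ} (hp : 1 ≤ p) {E Ω : Set X}
    (hΩ : IsOpen Ω) {A : ℝ≥0∞}
    (h : ∀ (v : X → ℝ) (G : X → ℝ≥0∞), AEMeasurable v μ → (∀ y, 0 ≤ v y) → (∀ y, v y ≤ 1) →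
      (∀ y ∈ E, v y = 1) → (∀ y, y ∉ Ω → v y = 0) → IsUpperGradient G (fun y => (v y : EReal)) →
      ∫⁻ y, G y ^ p ∂μ < ∞ → A ≤ ∫⁻ y, G y ^ p ∂μ) :
    A ≤ 2 ^ p * variationalCapacity p μ E Ω := by
  have h2 : (2 : ℝ≥0∞) ^ p ≠ 0 := by simp
  have h2' : (2 : ℝ≥0∞) ^ p ≠ ∞ := by simp
  rw [mul_comm, ← ENNReal.div_le_iff h2 h2']
  refine le_iInf fun u => le_iInf fun hu => le_iInf fun huE => le_iInf fun g => le_iInf fun hg =>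
    le_iInf fun hgfin => ?_
  rw [ENNReal.div_le_iff h2 h2', mul_comm]
  refine ENNReal.le_of_forall_pos_le_add fun δ hδ _ => ?_
  obtain ⟨G, hG, hGle⟩ := hg.exists_isUpperGradient_unitClamp hp hΩ hu.2
    (δ := (δ : ℝ≥0∞)) (by simpa using hδ.ne')
  refine (h (fun y => unitClamp (u y)) G (measurable_unitClamp.comp_aemeasurable hu.1.1)
    (fun y => unitClamp_nonneg _) (fun y => unitClamp_le_one _)
    (fun y hy => unitClamp_of_one_le (huE y hy))
    (fun y hy => by simp only [hu.2 y hy, unitClamp_zero]) hG ?_).trans hGle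
  refine hGle.trans_lt (ENNReal.add_lt_top.2 ⟨ENNReal.mul_lt_top h2'.lt_top ?_, by simp⟩)
  exact (setLIntegral_le_lintegral _ _).trans_lt hgfin

/-- The test function is 1 on B_s and decreases with slope 1/s to 0 at the boundary of B_{2s}. The
radius s stays free because s = r and s = R/2 are both needed. -/
theorem variationalCapacity_ball_le [BorelSpace X] {μ : Measure X}
    (hμ : ∀ (y : X) (r : ℝ), 0 < r → 0 < μ (ball y r) ∧ μ (ball y r) < ∞) {p : ℝ} (hp : 1 ≤ p)
    (x : X) {r s R : ℝ} (hs : 0 < s) (hrs : r ≤ s) (hsR : 2 * s ≤ R) :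
    variationalCapacity p μ (ball x r) (ball x R) ≤
      μ (ball x (2 * s)) / ENNReal.ofReal (s ^ p) := by
  have hp0 : 0 < p := by linarith
  set v : X → ℝ := fun y => max 0 (min 1 (2 - dist y x / s)) with hv
  set g : X → ℝ≥0∞ := (ball x (2 * s)).indicator fun _ => ENNReal.ofReal (1 / s) with hgdef
  have hv0 : ∀ y, 0 ≤ v y := fun y => le_max_left _ _
  have hv1 : ∀ y, v y ≤ 1 := fun y => max_le zero_le_one (min_le_left _ _)
  have hvout : ∀ y, y ∉ ball x (2 * s) → v y = 0 := by
    intro y hy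
    rw [mem_ball, not_lt] at hy
    have : 2 ≤ dist y x / s := by rwa [le_div_iff₀ hs]
    exact max_eq_left ((min_le_right _ _).trans (by linarith))
  have hvE : ∀ y ∈ ball x r, v y = 1 := by
    intro y hy
    have : dist y x / s ≤ 1 := by rw [div_le_one hs]; exact (mem_ball.1 hy).le.trans hrs
    simp only [hv]
    rw [min_eq_left (by linarith), max_eq_right zero_le_one]
  have hvlip : ∀ y z, |v y - v z| ≤ dist y z / s := by
    intro y z
    refine (abs_max_sub_max_le_max _ _ _ _).trans (max_le (by simp; positivity) ?_)
    refine (abs_min_sub_min_le_max _ _ _ _).trans (max_le (by simp; positivity) ?_)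
    have : (2 - dist y x / s) - (2 - dist z x / s) = (dist z x - dist y x) / s := by ring
    rw [this, abs_div, abs_of_pos hs]
    gcongr
    rw [dist_comm y z]
    exact abs_dist_sub_le _ _ _
  have hgm : Measurable g := measurable_const.indicator measurableSet_ball
  have hug : IsUpperGradient g fun y => (v y : EReal) := by
    refine ⟨hgm, fun l γ hγ => ?_⟩
    rw [EReal.abs_coe_sub_coe]
    -- The constant 1/s is an upper gradient by the Lipschitz bound, and it may be cut off outside
    -- B_{2s}, where v vanishes.
    refine hγ.abs_sub_le_indicator isOpen_ball hv0 hvout fun a b ha hab hb => ?_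
    rw [setLIntegral_const, Real.volume_Icc, ← ENNReal.ofReal_mul (by positivity)]
    refine ENNReal.ofReal_le_ofReal ((hvlip _ _).trans ?_)
    rw [div_mul_eq_mul_div, one_mul]
    gcongr
    exact hγ.dist_le ha hab.le hb
  have hgp : ∫⁻ y, g y ^ p ∂μ = μ (ball x (2 * s)) / ENNReal.ofReal (s ^ p) := by
    have : ∀ y, g y ^ p = (ball x (2 * s)).indicator (fun _ => ENNReal.ofReal (1 / s) ^ p) y := by
      intro y
      by_cases hy : y ∈ ball x (2 * s) <;> simp [hgdef, hy, hp0]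
    simp_rw [this]
    rw [lintegral_indicator_const measurableSet_ball, ENNReal.ofReal_rpow_of_pos (by positivity),
      Real.div_rpow zero_le_one hs.le, Real.one_rpow, one_div,
      ENNReal.ofReal_inv_of_pos (by positivity), mul_comm, div_eq_mul_inv]
  have hfin : ∫⁻ y, g y ^ p ∂μ < ∞ := by
    rw [hgp]
    exact ENNReal.div_lt_top (hμ x _ (by positivity)).2.ne
      (by simpa using Real.rpow_pos_of_pos hs p)
  have hvm : Measurable v := by
    have : Continuous v := by simp only [hv]; fun_prop
    exact this.measurable
  have hmem : MemNewtonianZero p μ (ball x R) fun y => (v y : EReal) := by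
    refine ⟨⟨hvm.coe_real_ereal.aemeasurable, ?_⟩, fun y hy => ?_⟩
    · refine ENNReal.rpow_lt_top_of_nonneg (by positivity) (ENNReal.add_lt_top.2 ⟨?_, ?_⟩).ne
      · refine lt_of_le_of_lt (lintegral_mono (g := (ball x (2 * s)).indicator fun _ => 1) ?_) ?_
        · intro y
          by_cases hy : y ∈ ball x (2 * s)
          · simp only [hy, indicator_of_mem, EReal.abs_def]
            refine ENNReal.rpow_le_one ?_ hp0.le
            rw [abs_of_nonneg (hv0 y)]
            simpa using hv1 y
          · simp [hvout y hy, hp0]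
        · rw [lintegral_indicator_const measurableSet_ball, one_mul]
          exact (hμ x _ (by positivity)).2
      · exact (iInf₂_le g hug).trans_lt hfin
    · simp [hvout y fun h => hy (ball_subset_ball hsR h)]
  have hweak : IsWeakUpperGradient p μ g fun y => (v y : EReal) :=
    ⟨hgm.aemeasurable, fun _ => 0, measurable_const, by simp [hp0],
      fun l γ hγ hn => absurd (hug.2 l γ hγ) hn⟩
  rw [← hgp]
  refine (iInf₂_le _ hmem).trans ((iInf_le _ fun y hy => by simp [hvE y hy]).trans ?_)
  exact (iInf₂_le g hweak).trans ((iInf_le _ hfin).trans (setLIntegral_le_lintegral _ _))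

end Capacity

/-! ### Consequences of the Poincaré inequality: nonempty shells and telescoping averages. -/

section Poincare

theorem integrableOn_of_mem_unitInterval {α : Type*} [MeasurableSpace α] {μ : Measure α} {A : Set α}
    (hA : μ A < ∞) {v : α → ℝ} (hvm : AEMeasurable v μ) (hv0 : ∀ y, 0 ≤ v y) (hv1 : ∀ y, v y ≤ 1) :
    IntegrableOn v A μ := by
  have : IsFiniteMeasure (μ.restrict A) := ⟨by simpa using hA⟩
  refine Integrable.of_bound hvm.aestronglyMeasurable.restrict 1 (ae_of_all _ fun y => ?_)
  rw [Real.norm_eq_abs, abs_of_nonneg (hv0 y)]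
  exact hv1 y

theorem ofReal_abs_setAverage_sub_le {α : Type*} [MeasurableSpace α] {μ : Measure α} {A : Set α}
    (hA0 : μ A ≠ 0) (hA : μ A ≠ ∞) {v : α → ℝ}
    (hv : IntegrableOn v A μ) (m : ℝ) :
    ENNReal.ofReal |⨍ y in A, v y ∂μ - m| ≤ (∫⁻ y in A, ENNReal.ofReal |v y - m| ∂μ) / μ A := by
  have hA' : μ.real A ≠ 0 := (ENNReal.toReal_pos hA0 hA).ne'
  have h1 : ⨍ y in A, v y ∂μ - m = (μ.real A)⁻¹ * ∫ y in A, (v y - m) ∂μ := by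
    rw [integral_sub hv (integrableOn_const hA), setAverage_eq, setIntegral_const, smul_eq_mul,
      smul_eq_mul, mul_sub, inv_mul_cancel_left₀ hA']
  have h2 := enorm_integral_le_lintegral_enorm (μ := μ.restrict A) fun y => v y - m
  simp only [Real.enorm_eq_ofReal_abs] at h2
  rw [h1, abs_mul, ENNReal.ofReal_mul (abs_nonneg _), abs_inv, abs_of_nonneg measureReal_nonneg,
    ENNReal.ofReal_inv_of_pos (measureReal_nonneg.lt_of_ne' hA'), ofReal_measureReal hA, mul_comm,
    div_eq_mul_inv]
  gcongr

variable {X : Type*} [MetricSpace X] [MeasurableSpace X] [BorelSpace X] {μ : Measure X} {p C Λ : ℝ}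

/-- The conclusion of the `p`-Poincaré inequality with constants `C` and `Λ`. -/
def PoincareInequality (p C Λ : ℝ) (μ : Measure X) : Prop :=
  ∀ (x : X) (r : ℝ), 0 < r →
    ∀ (f : X → EReal) (g : X → ℝ≥0∞), AEMeasurable f μ → ∫⁻ y, (f y).abs ∂μ < ∞ →
      IsUpperGradient g f →
        ⨍⁻ y in ball x r, ENNReal.ofReal |(f y).toReal - ⨍ z in ball x r, (f z).toReal ∂μ| ∂μ ≤
          ENNReal.ofReal (C * r) * (⨍⁻ y in ball x (Λ * r), g y ^ p ∂μ) ^ (1 / p)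

/-- The dilation Λ disappears by enlarging the right-hand side: the energy on the dilated ball is at
most the total energy, and the dilated ball has at least the measure of the original one. The
bounded support of v serves only to make v integrable. -/
theorem PoincareInequality.lintegral_le (hP : PoincareInequality p C Λ μ)
    (hμ : ∀ (y : X) (r : ℝ), 0 < r → 0 < μ (ball y r) ∧ μ (ball y r) < ∞) (hp : 0 < p)
    (hΛ : 1 ≤ Λ) {x : X} {R : ℝ} (hR : 0 < R) {v : X → ℝ} {G : X → ℝ≥0∞} (hvm : AEMeasurable v μ)
    (hv0 : ∀ y, 0 ≤ v y) (hv1 : ∀ y, v y ≤ 1) (hvR : ∀ y, y ∉ ball x R → v y = 0)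
    (hG : IsUpperGradient G fun y => (v y : EReal)) (y : X) {s : ℝ} (hs : 0 < s) :
    (∫⁻ z in ball y s, ENNReal.ofReal |v z - ⨍ w in ball y s, v w ∂μ| ∂μ) / μ (ball y s) ≤
      ENNReal.ofReal (C * s) * ((∫⁻ z, G z ^ p ∂μ) / μ (ball y s)) ^ (1 / p) := by
  have h := hP y s hs (fun z => (v z : EReal)) G hvm.coe_real_ereal ?_ hG
  · simp only [EReal.toReal_coe] at h
    rw [setLAverage_eq] at h
    refine h.trans ?_
    gcongr
    rw [setLAverage_eq]
    gcongr
    · exact Measure.restrict_le_self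
    · exact le_mul_of_one_le_left hs.le hΛ
  · refine lt_of_le_of_lt (lintegral_mono (g := (ball x R).indicator fun _ => 1) fun z => ?_) ?_
    · by_cases hz : z ∈ ball x R
      · simp only [hz, indicator_of_mem, EReal.abs_def]
        rw [abs_of_nonneg (hv0 z)]
        simpa using hv1 z
      · simp [hvR z hz]
    · rw [lintegral_indicator_const measurableSet_ball, one_mul]
      exact (hμ x R hR).2

/-- A space supporting a Poincaré inequality has no empty shells. -/
theorem PoincareInequality.exists_mem_shell (hP : PoincareInequality p C Λ μ)
    (hμ : ∀ (y : X) (r : ℝ), 0 < r → 0 < μ (ball y r) ∧ μ (ball y r) < ∞) (hp : 0 < p)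
    (hΛ : 1 ≤ Λ) {x : X} {a b : ℝ} (ha : 0 < a) (hab : a < b) (hfar : ∃ y, a ≤ dist y x) :
    ∃ y, a ≤ dist y x ∧ dist y x < b := by
  by_contra! hempty
  obtain ⟨z, hz⟩ := hfar
  -- An empty shell makes the open and the closed ball of radius a coincide, so the ball is clopen.
  have hclosed : IsClosed (ball x a) := by
    have : ball x a = closedBall x a := by
      refine subset_antisymm ball_subset_closedBall fun y hy => ?_
      by_contra hc
      have := hempty y (not_lt.1 hc)
      linarith [mem_closedBall.1 hy]
    rw [this]; exact isClosed_closedBall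
  have hclopen : IsClopen (ball x a) := ⟨hclosed, isOpen_ball⟩
  set v : X → ℝ := (ball x a).indicator fun _ => 1 with hv
  have hin : ∀ y ∈ ball x a, v y = 1 := fun y hy => by simp [hv, indicator_of_mem hy]
  have hout : ∀ y, y ∉ ball x a → v y = 0 := fun y hy => by simp [hv, indicator_of_notMem hy]
  -- A curve cannot leave a clopen set, so the indicator is constant along it. Poincaré then forces
  -- the indicator to be almost everywhere constant on every ball.
  have hG : IsUpperGradient (fun _ => 0) fun y => (v y : EReal) := by
    refine ⟨measurable_const, fun l γ hγ => ?_⟩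
    have hpre : IsPreconnected (γ '' Icc 0 l) := isPreconnected_Icc.image γ hγ.continuousOn
    have h0 : γ 0 ∈ γ '' Icc 0 l := mem_image_of_mem _ ⟨le_rfl, hγ.1.le⟩
    have hl : γ l ∈ γ '' Icc 0 l := mem_image_of_mem _ ⟨hγ.1.le, le_rfl⟩
    have : v (γ 0) = v (γ l) := by
      by_cases h : γ 0 ∈ ball x a
      · rw [hin _ h, hin _ (hpre.subset_isClopen hclopen ⟨_, h0, h⟩ hl)]
      · rw [hout _ h, hout _ (hpre.subset_isClopen hclopen.compl ⟨_, h0, h⟩ hl)]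
    rw [EReal.abs_coe_sub_coe, this]
    simp
  obtain ⟨ε, hε, hεz⟩ := Metric.isOpen_iff.1 hclosed.isOpen_compl z
    (by simpa using hz)
  -- Large enough for B(x, s) to contain both B(x, a), where v = 1, and B(z, ε), where v = 0.
  set s : ℝ := a + dist z x + ε with hs
  have hs0 : 0 < s := by positivity
  have h := hP.lintegral_le hμ hp hΛ ha (v := v)
    (measurable_const.indicator measurableSet_ball).aemeasurable
    (fun y => indicator_nonneg (fun _ _ => zero_le_one) y)
    (fun y => indicator_le_self' (fun _ _ => zero_le_one) y |>.trans le_rfl) hout hG x hs0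
  set m := ⨍ w in ball x s, v w ∂μ with hm
  have hzero : ∫⁻ y in ball x s, ENNReal.ofReal |v y - m| ∂μ = 0 := by
    have : (∫⁻ _ : X, (0 : ℝ≥0∞) ^ p ∂μ) = 0 := by simp [hp]
    rw [this] at h
    simp [hp] at h
    rcases h with h | h
    · exact h
    · exact absurd h (hμ x s hs0).2.ne
  have hconst : ∀ (A : Set X) (c : ℝ), MeasurableSet A → A ⊆ ball x s → μ A ≠ 0 →
      (∀ y ∈ A, v y = c) → c = m := by
    intro A c hAm hA hA0 hc
    have h1 : ∫⁻ y in A, ENNReal.ofReal |v y - m| ∂μ = 0 :=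
      le_antisymm ((lintegral_mono_set hA).trans hzero.le) bot_le
    rw [setLIntegral_congr_fun (g := fun _ => ENNReal.ofReal |c - m|) hAm
      (fun y hy => by simp only [hc y hy]), setLIntegral_const] at h1
    rcases mul_eq_zero.1 h1 with h2 | h2
    · rw [ENNReal.ofReal_eq_zero] at h2
      linarith [abs_nonpos_iff.1 h2]
    · exact absurd h2 hA0
  have e1 := hconst (ball x a) 1 measurableSet_ball
    (ball_subset_ball (by rw [hs]; linarith [dist_nonneg (x := z) (y := x)])) (hμ x a ha).1.ne' hin
  have e0 := hconst (ball z ε) 0 measurableSet_ball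
    (ball_subset_ball' (by rw [hs]; linarith)) (hμ z ε hε).1.ne' fun y hy => hout y (hεz hy)
  linarith

variable {D : ℝ}

/-- Subtract the mean over the doubled ball, enlarge the domain of integration to that ball at the
cost of the doubling constant, and apply Poincaré there. -/
theorem PoincareInequality.abs_setAverage_sub_le (hP : PoincareInequality p C Λ μ) (hC : 0 < C)
    (hμ : ∀ (y : X) (r : ℝ), 0 < r → 0 < μ (ball y r) ∧ μ (ball y r) < ∞) (hp : 0 < p)
    (hΛ : 1 ≤ Λ) (hD : 0 < D)
    (hdouble : ∀ (y : X) (r : ℝ), 0 < r → μ (ball y (2 * r)) ≤ ENNReal.ofReal D * μ (ball y r))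
    {x : X} {R : ℝ} (hR : 0 < R) {v : X → ℝ} {G : X → ℝ≥0∞} (hvm : AEMeasurable v μ)
    (hv0 : ∀ y, 0 ≤ v y) (hv1 : ∀ y, v y ≤ 1) (hvR : ∀ y, y ∉ ball x R → v y = 0)
    (hG : IsUpperGradient G fun y => (v y : EReal)) (hGp : ∫⁻ z, G z ^ p ∂μ < ∞) (y : X) {s : ℝ}
    (hs : 0 < s) :
    |⨍ z in ball y s, v z ∂μ - ⨍ z in ball y (2 * s), v z ∂μ| ≤ D * (C * (2 * s)) *
      ((∫⁻ z, G z ^ p ∂μ).toReal / μ.real (ball y (2 * s))) ^ (1 / p) := by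
  have h2s : 0 < 2 * s := by positivity
  obtain ⟨hs1, hs2⟩ := hμ y s hs
  obtain ⟨ht1, ht2⟩ := hμ y (2 * s) h2s
  have ht3 : 0 < μ.real (ball y (2 * s)) := ENNReal.toReal_pos ht1.ne' ht2.ne
  have h := hP.lintegral_le hμ hp hΛ hR hvm hv0 hv1 hvR hG y h2s
  set m := ⨍ z in ball y (2 * s), v z ∂μ
  have h1 := ofReal_abs_setAverage_sub_le hs1.ne' hs2.ne
    (integrableOn_of_mem_unitInterval hs2 hvm hv0 hv1) m
  have hinv : (μ (ball y s))⁻¹ ≤ ENNReal.ofReal D * (μ (ball y (2 * s)))⁻¹ := by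
    rw [ENNReal.inv_le_iff_le_mul (by simp [hs1.ne']) (by simp [hs2.ne]), mul_comm,
      mul_assoc, mul_comm _ (μ (ball y s)), ← mul_assoc, ← div_eq_mul_inv,
      ENNReal.le_div_iff_mul_le (by simp [ht1.ne']) (by simp [ht2.ne]), one_mul]
    exact hdouble y s hs
  have h2 : ENNReal.ofReal |⨍ z in ball y s, v z ∂μ - m| ≤ ENNReal.ofReal (D * (C * (2 * s)) *
      ((∫⁻ z, G z ^ p ∂μ).toReal / μ.real (ball y (2 * s))) ^ (1 / p)) := by
    calc ENNReal.ofReal |⨍ z in ball y s, v z ∂μ - m|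
        ≤ (∫⁻ z in ball y s, ENNReal.ofReal |v z - m| ∂μ) / μ (ball y s) := h1
      _ ≤ (∫⁻ z in ball y (2 * s), ENNReal.ofReal |v z - m| ∂μ) *
          (ENNReal.ofReal D * (μ (ball y (2 * s)))⁻¹) := by
        rw [div_eq_mul_inv]
        exact mul_le_mul' (lintegral_mono_set (ball_subset_ball (by linarith))) hinv
      _ = ENNReal.ofReal D *
          ((∫⁻ z in ball y (2 * s), ENNReal.ofReal |v z - m| ∂μ) / μ (ball y (2 * s))) := by
        rw [div_eq_mul_inv]; ring
      _ ≤ ENNReal.ofReal D * (ENNReal.ofReal (C * (2 * s)) *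
          ((∫⁻ z, G z ^ p ∂μ) / μ (ball y (2 * s))) ^ (1 / p)) := by gcongr
      _ = _ := by
        have hq : (∫⁻ z, G z ^ p ∂μ) / μ (ball y (2 * s)) =
            ENNReal.ofReal ((∫⁻ z, G z ^ p ∂μ).toReal / μ.real (ball y (2 * s))) := by
          rw [ENNReal.ofReal_div_of_pos ht3,
            ENNReal.ofReal_toReal hGp.ne, ofReal_measureReal ht2.ne]
        rw [hq, ENNReal.ofReal_rpow_of_nonneg (by positivity) (by positivity), ← mul_assoc,
          ← ENNReal.ofReal_mul hD.le, ← ENNReal.ofReal_mul (by positivity)]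
  exact (ENNReal.ofReal_le_ofReal_iff (by positivity)).1 h2

/-- The averages of v over the balls of radius 2^j r drop from 1 to at most 1 - D⁻⁴, and the sum of
the successive differences controls the drop. -/
theorem PoincareInequality.inv_le_sum (hP : PoincareInequality p C Λ μ) (hC : 0 < C)
    (hμ : ∀ (y : X) (r : ℝ), 0 < r → 0 < μ (ball y r) ∧ μ (ball y r) < ∞) (hp : 0 < p)
    (hΛ : 1 ≤ Λ) (hD : 0 < D)
    (hdouble : ∀ (y : X) (r : ℝ), 0 < r → μ (ball y (2 * r)) ≤ ENNReal.ofReal D * μ (ball y r))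
    {x : X} {r R : ℝ} (hr : 0 < r) (hR : 0 < R) (hfar : ∃ y, 2 * R ≤ dist y x)
    {v : X → ℝ} {G : X → ℝ≥0∞} (hvm : AEMeasurable v μ)
    (hv0 : ∀ y, 0 ≤ v y) (hv1 : ∀ y, v y ≤ 1) (hvr : ∀ y ∈ ball x r, v y = 1)
    (hvR : ∀ y, y ∉ ball x R → v y = 0)
    (hG : IsUpperGradient G fun y => (v y : EReal)) (hGp : ∫⁻ z, G z ^ p ∂μ < ∞) {N : ℕ}
    (hN : 4 * R ≤ 2 ^ N * r) (hN' : 2 ^ N * r ≤ 8 * R) :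
    (D ^ 4)⁻¹ ≤ ∑ j ∈ Finset.range N, D * (C * (2 ^ (j + 1) * r)) *
      ((∫⁻ z, G z ^ p ∂μ).toReal / μ.real (ball x (2 ^ (j + 1) * r))) ^ (1 / p) := by
  -- With 2R ≤ d(y, x) < 3R, the ball B(y, R) misses B(x, R) and lies in B(x, 4R) ⊆ B(x, T). Since T
  -- ≤ 8R, also B(x, T) ⊆ B(y, 16R), so four doublings compare the measures.
  obtain ⟨y, hy1, hy2⟩ := hP.exists_mem_shell hμ hp hΛ (x := x) (a := 2 * R) (b := 3 * R)
    (by positivity) (by linarith) hfar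
  set T : ℝ := 2 ^ N * r with hT
  have hT0 : 0 < T := by positivity
  obtain ⟨hT1, hT2⟩ := hμ x T hT0
  set a : ℕ → ℝ := fun j => ⨍ z in ball x (2 ^ j * r), v z ∂μ with ha
  have hint := integrableOn_of_mem_unitInterval hT2 hvm hv0 hv1
  have ha0 : a 0 = 1 := by
    simp only [ha, pow_zero, one_mul]
    rw [setAverage_eq, setIntegral_congr_fun (g := fun _ => 1) measurableSet_ball hvr,
      setIntegral_const, smul_eq_mul, smul_eq_mul, mul_one]
    exact inv_mul_cancel₀ (ENNReal.toReal_pos (hμ x r hr).1.ne' (hμ x r hr).2.ne).ne'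
  have hsub : ball y R ⊆ ball x T := ball_subset_ball' (by linarith)
  have hdisj : ∀ z ∈ ball y R, z ∉ ball x R := by
    intro z hz hz'
    rw [mem_ball] at hz hz'
    linarith [dist_triangle_left y x z]
  have hmeas : μ.real (ball x T) ≤ D ^ 4 * μ.real (ball y R) := by
    have hd : ∀ s, 0 < s → μ.real (ball y (2 * s)) ≤ D * μ.real (ball y s) := by
      intro s hs
      have := ENNReal.toReal_mono (ENNReal.mul_ne_top ENNReal.ofReal_ne_top (hμ y s hs).2.ne)
        (hdouble y s hs)
      rwa [ENNReal.toReal_mul, ENNReal.toReal_ofReal hD.le] at this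
    have h0 : μ.real (ball x T) ≤ μ.real (ball y (2 * (2 * (2 * (2 * R))))) :=
      measureReal_mono (ball_subset_ball' (by rw [dist_comm]; linarith)) (hμ y _ (by positivity)).2.ne
    calc μ.real (ball x T) ≤ μ.real (ball y (2 * (2 * (2 * (2 * R))))) := h0
      _ ≤ D * (D * (D * (D * μ.real (ball y R)))) := by
        refine (hd _ (by positivity)).trans (mul_le_mul_of_nonneg_left ?_ hD.le)
        refine (hd _ (by positivity)).trans (mul_le_mul_of_nonneg_left ?_ hD.le)
        refine (hd _ (by positivity)).trans (mul_le_mul_of_nonneg_left ?_ hD.le)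
        exact hd _ hR
      _ = D ^ 4 * μ.real (ball y R) := by ring
  have hTr : 0 < μ.real (ball x T) := ENNReal.toReal_pos hT1.ne' hT2.ne
  -- v vanishes on B(y, R), a proportion at least D⁻⁴ of B(x, T), and is at most 1 elsewhere.
  have haN : a N ≤ 1 - (D ^ 4)⁻¹ := by
    have h1 : ∫ z in ball x T, v z ∂μ ≤ μ.real (ball x T) - μ.real (ball y R) := by
      rw [← measureReal_sdiff hsub measurableSet_ball hT2.ne]
      have h2 : ∫ z in ball x T, v z ∂μ = ∫ z in ball x T \ ball y R, v z ∂μ := by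
        refine setIntegral_eq_of_subset_of_forall_sdiff_eq_zero measurableSet_ball sdiff_subset ?_
        intro z hz
        have : z ∈ ball y R := by
          by_contra hc
          exact hz.2 ⟨hz.1, hc⟩
        exact hvR z (hdisj z this)
      have hfin : μ (ball x T \ ball y R) ≠ ∞ := measure_ne_top_of_subset sdiff_subset hT2.ne
      rw [h2]
      calc ∫ z in ball x T \ ball y R, v z ∂μ ≤ ∫ _ in ball x T \ ball y R, (1 : ℝ) ∂μ :=
            setIntegral_mono (hint.mono_set sdiff_subset) (integrableOn_const hfin) hv1
        _ = μ.real (ball x T \ ball y R) := by simp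
    have h3 : a N = (∫ z in ball x T, v z ∂μ) / μ.real (ball x T) := by
      simp only [ha]
      rw [setAverage_eq, smul_eq_mul, inv_mul_eq_div]
    rw [h3, div_le_iff₀ hTr]
    have h4 : (D ^ 4)⁻¹ * μ.real (ball x T) ≤ μ.real (ball y R) := by
      rw [inv_mul_le_iff₀ (by positivity)]
      exact hmeas
    linarith
  have hsum := dist_le_range_sum_dist a N
  calc (D ^ 4)⁻¹ ≤ dist (a 0) (a N) := by
        rw [Real.dist_eq, ha0]
        exact le_trans (by linarith) (le_abs_self _)
    _ ≤ _ := hsum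
    _ ≤ _ := by
      refine Finset.sum_le_sum fun j _ => ?_
      have := hP.abs_setAverage_sub_le hC hμ hp hΛ hD hdouble hR hvm hv0 hv1 hvR hG hGp x
        (s := 2 ^ j * r) (by positivity)
      rwa [← mul_assoc, ← pow_succ'] at this

end Poincare

/-! ### Geometric sums, and extension of power comparisons to larger radii. -/

section RealEstimates

theorem sum_range_pow_le {τ : ℝ} (h0 : 0 ≤ τ) (h1 : τ < 1) (N : ℕ) :
    ∑ j ∈ Finset.range N, τ ^ j ≤ (1 - τ)⁻¹ := by
  rw [← tsum_geometric_of_lt_one h0 h1]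
  exact (summable_geometric_of_lt_one h0 h1).sum_le_tsum _ fun _ _ => by positivity

/-- Since s (E/m)^{1/p} = (E s^p/m)^{1/p}, the terms are dominated by (EK)^{1/p} times powers of
θ^{1/p}, so the whole sum is of the order of (EK)^{1/p}. The exponents e allow the dominant term to
sit at either end of the sum. -/
theorem inv_le_rpow_mul_of_le_sum {p c B E K S θ : ℝ} (hp : 0 < p) (hc : 0 < c) (hB : 0 < B)
    (hE : 0 ≤ E) (hK : 0 < K) (hθ : 0 < θ) {N : ℕ} {s m : ℕ → ℝ} {e : ℕ → ℕ}
    (hs : ∀ j, 0 < s j) (hm : ∀ j, 0 < m j)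
    (hdecay : ∀ j < N, s j ^ p / m j ≤ K * θ ^ e j)
    (hS : ∑ j ∈ Finset.range N, (θ ^ (1 / p)) ^ e j ≤ S)
    (h : c ≤ ∑ j ∈ Finset.range N, B * s j * (E / m j) ^ (1 / p)) :
    K⁻¹ ≤ (B * S / c) ^ p * E := by
  have hS0 : 0 ≤ S := le_trans (Finset.sum_nonneg fun j _ => by positivity) hS
  have hterm : ∀ j < N, s j * (E / m j) ^ (1 / p) ≤ (E * K) ^ (1 / p) * (θ ^ (1 / p)) ^ e j := by
    intro j hj
    have e1 : s j * (E / m j) ^ (1 / p) = (E * (s j ^ p / m j)) ^ (1 / p) := by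
      have : E * (s j ^ p / m j) = s j ^ p * (E / m j) := by ring
      rw [this, Real.mul_rpow (by have := hs j; positivity) (by have := hm j; positivity),
        ← Real.rpow_mul (hs j).le, mul_one_div_cancel hp.ne', Real.rpow_one]
    have e2 : (θ ^ (1 / p)) ^ e j = (θ ^ e j) ^ (1 / p) := by
      rw [← Real.rpow_natCast, ← Real.rpow_mul hθ.le, mul_comm, Real.rpow_mul hθ.le,
        Real.rpow_natCast]
    rw [e1, e2, ← Real.mul_rpow (by positivity) (by positivity), mul_assoc]
    have := hs j
    have := hm j
    exact Real.rpow_le_rpow (by positivity) (mul_le_mul_of_nonneg_left (hdecay j hj) hE)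
      (by positivity)
  have h1 : c ≤ B * S * (E * K) ^ (1 / p) := by
    calc c ≤ ∑ j ∈ Finset.range N, B * s j * (E / m j) ^ (1 / p) := h
      _ ≤ ∑ j ∈ Finset.range N, B * ((E * K) ^ (1 / p) * (θ ^ (1 / p)) ^ e j) := by
        refine Finset.sum_le_sum fun j hj => ?_
        rw [mul_assoc]
        exact mul_le_mul_of_nonneg_left (hterm j (Finset.mem_range.1 hj)) hB.le
      _ = B * (E * K) ^ (1 / p) * ∑ j ∈ Finset.range N, (θ ^ (1 / p)) ^ e j := by
        rw [Finset.mul_sum]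
        exact Finset.sum_congr rfl fun j _ => by ring
      _ ≤ B * (E * K) ^ (1 / p) * S := mul_le_mul_of_nonneg_left hS (by positivity)
      _ = _ := by ring
  have h2 : 1 ≤ B * S / c * (E * K) ^ (1 / p) := by
    rw [div_mul_eq_mul_div, le_div_iff₀ hc, one_mul]; exact h1
  have h3 := Real.rpow_le_rpow zero_le_one h2 hp.le
  rw [Real.one_rpow, Real.mul_rpow (by positivity) (by positivity),
    ← Real.rpow_mul (by positivity), one_div_mul_cancel hp.ne', Real.rpow_one, ← mul_assoc] at h3
  rwa [← one_div, div_le_iff₀ hK]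

/-- Radii in [a, L] are comparable to each other, so passing through the radius a changes only the
constant. -/
theorem div_le_mul_rpow_extend {m : ℝ → ℝ} (hm0 : ∀ r, 0 < r → 0 < m r)
    (hm : ∀ r s, 0 < r → r ≤ s → m r ≤ m s) {q C a : ℝ} (hq : 0 < q) (hC : 0 < C) (ha : 0 < a)
    (h : ∀ r R, 0 < r → r < R → R ≤ a → m r / m R ≤ C * (r / R) ^ q) (M : ℝ) :
    ∃ K, 0 < K ∧ ∀ r R, 0 < r → r ≤ R → R ≤ M → m r / m R ≤ K * (r / R) ^ q := by
  set L : ℝ := max M a with hL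
  have hL0 : 0 < L := ha.trans_le (le_max_right _ _)
  have hLa : 1 ≤ L / a := by rw [one_le_div ha]; exact le_max_right _ _
  have hLq : 1 ≤ (L / a) ^ q := Real.one_le_rpow hLa hq.le
  -- The extra 1 handles r = R and r ≥ a, where the only bound used on the measure ratio is 1.
  refine ⟨(C + 1) * (L / a) ^ q, by positivity, fun r R hr hrR hRM => ?_⟩
  have hR : 0 < R := hr.trans_le hrR
  have hRL : R ≤ L := hRM.trans (le_max_left _ _)
  have hratio : m r / m R ≤ 1 := (div_le_one (hm0 R hR)).2 (hm r R hr hrR)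
  have hpos : 0 < (r / R) ^ q := by positivity
  have hbig : a ≤ r → m r / m R ≤ (C + 1) * (L / a) ^ q * (r / R) ^ q := by
    intro har
    have h1 : 1 ≤ (L / a) ^ q * (r / R) ^ q := by
      rw [← Real.mul_rpow (by positivity) (by positivity)]
      refine Real.one_le_rpow ?_ hq.le
      rw [div_mul_div_comm, one_le_div (by positivity), mul_comm a]
      exact mul_le_mul hRL har ha.le hL0.le
    nlinarith
  rcases le_or_gt a r with har | har
  · exact hbig har
  rcases le_or_gt R a with hRa | hRa
  · rcases hrR.eq_or_lt with rfl | hlt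
    · rw [div_self hr.ne', Real.one_rpow]
      nlinarith
    · refine (h r R hr hlt hRa).trans (mul_le_mul_of_nonneg_right ?_ hpos.le)
      nlinarith
  · calc m r / m R ≤ m r / m a :=
          div_le_div_of_nonneg_left (hm0 r hr).le (hm0 a ha) (hm a R ha hRa.le)
      _ ≤ C * (r / a) ^ q := h r a hr har le_rfl
      _ ≤ C * ((L / a) * (r / R)) ^ q := by
        have : r / a ≤ (L / a) * (r / R) := by
          rw [div_mul_div_comm, div_le_div_iff₀ ha (by positivity)]
          nlinarith [mul_le_mul_of_nonneg_left hRL (mul_pos hr ha).le]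
        gcongr
      _ = C * (L / a) ^ q * (r / R) ^ q := by
        rw [Real.mul_rpow (by positivity) (by positivity), mul_assoc]
      _ ≤ _ := by
        refine mul_le_mul_of_nonneg_right ?_ hpos.le
        nlinarith

/-- Here monotonicity alone goes the wrong way for R > a. The loss is bounded by k = m(a)/m(L),
which limits the growth of m between a and L. -/
theorem mul_rpow_le_div_extend {m : ℝ → ℝ} (hm0 : ∀ r, 0 < r → 0 < m r)
    (hm : ∀ r s, 0 < r → r ≤ s → m r ≤ m s) {q C a : ℝ} (hq : 0 < q) (hC : 0 < C) (ha : 0 < a)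
    (h : ∀ r R, 0 < r → r < R → R ≤ a → C * (r / R) ^ q ≤ m r / m R) (M : ℝ) :
    ∃ K, 0 < K ∧ ∀ r R, 0 < r → r ≤ R → R ≤ M → K * (r / R) ^ q ≤ m r / m R := by
  set L : ℝ := max M a with hL
  have hL0 : 0 < L := ha.trans_le (le_max_right _ _)
  have hma := hm0 a ha
  have hmL := hm0 L hL0
  set k : ℝ := m a / m L with hk
  have hk0 : 0 < k := by positivity
  have hk1 : k ≤ 1 := (div_le_one hmL).2 (hm a L ha (le_max_right _ _))
  set c : ℝ := min C 1 with hc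
  have hc0 : 0 < c := lt_min hC one_pos
  have hcC : c ≤ C := min_le_left _ _
  have hc1 : c ≤ 1 := min_le_right _ _
  refine ⟨c * k, by positivity, fun r R hr hrR hRM => ?_⟩
  have hR : 0 < R := hr.trans_le hrR
  have hRL : R ≤ L := hRM.trans (le_max_left _ _)
  have hmR := hm0 R hR
  have hmr := hm0 r hr
  have hpos : 0 < (r / R) ^ q := by positivity
  have hle1 : (r / R) ^ q ≤ 1 :=
    Real.rpow_le_one (by positivity) ((div_le_one hR).2 hrR) hq.le
  have hkR : k ≤ m a / m R := div_le_div_of_nonneg_left hma.le hmR (hm R L hR hRL)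
  rcases le_or_gt a r with har | har
  · calc c * k * (r / R) ^ q ≤ 1 * k * 1 := by gcongr
      _ = k := by ring
      _ ≤ m a / m R := hkR
      _ ≤ m r / m R := by gcongr; exact hm a r ha har
  rcases le_or_gt R a with hRa | hRa
  · rcases hrR.eq_or_lt with rfl | hlt
    · rw [div_self hr.ne', Real.one_rpow, div_self hmr.ne']
      nlinarith
    · refine le_trans (mul_le_mul_of_nonneg_right ?_ hpos.le) (h r R hr hlt hRa)
      nlinarith
  · calc c * k * (r / R) ^ q ≤ C * (m a / m R) * (r / a) ^ q := by gcongr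
      _ = C * (r / a) ^ q * (m a / m R) := by ring
      _ ≤ m r / m a * (m a / m R) := by
        gcongr
        exact h r a hr har le_rfl
      _ = m r / m R := by field_simp

end RealEstimates

/-! ### Lower bound for the capacity under geometric decay. -/

section CapacityEstimates

variable {X : Type*} [MetricSpace X] [MeasurableSpace X] [BorelSpace X] {μ : Measure X}
  {p C Λ D : ℝ}

/-- Lower capacity bound when `s ^ p / μ (ball x s)` decays geometrically, as the exponent `e`
prescribes, along the dyadic radii `s` between `r` and a multiple of `R`. -/
theorem PoincareInequality.ofReal_inv_le_variationalCapacity (hP : PoincareInequality p C Λ μ)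
    (hC : 0 < C) (hμ : ∀ (y : X) (r : ℝ), 0 < r → 0 < μ (ball y r) ∧ μ (ball y r) < ∞)
    (hp : 1 ≤ p) (hΛ : 1 ≤ Λ) (hD : 0 < D)
    (hdouble : ∀ (y : X) (r : ℝ), 0 < r → μ (ball y (2 * r)) ≤ ENNReal.ofReal D * μ (ball y r))
    {θ : ℝ} (hθ : 0 < θ) (hθ1 : θ < 1) :
    ∃ M, 0 < M ∧ ∀ (x : X) (r R K : ℝ) (N : ℕ) (e : ℕ → ℕ), 0 < r → 0 < R → 0 < K →
      (∃ y, 2 * R ≤ dist y x) → 4 * R ≤ 2 ^ N * r → 2 ^ N * r ≤ 8 * R →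
      (∀ τ : ℝ, ∑ j ∈ Finset.range N, τ ^ e j = ∑ j ∈ Finset.range N, τ ^ j) →
      (∀ j < N, (2 ^ (j + 1) * r) ^ p / μ.real (ball x (2 ^ (j + 1) * r)) ≤ K * θ ^ e j) →
      ENNReal.ofReal K⁻¹ ≤ ENNReal.ofReal M * variationalCapacity p μ (ball x r) (ball x R) := by
  have hp0 : 0 < p := by linarith
  have hτ0 : 0 < θ ^ (1 / p) := by positivity
  have hτ1 : θ ^ (1 / p) < 1 := Real.rpow_lt_one hθ.le hθ1 (by positivity)
  set S : ℝ := (1 - θ ^ (1 / p))⁻¹ with hS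
  have hS0 : 0 < S := inv_pos.2 (by linarith)
  set M : ℝ := (D * C * S / (D ^ 4)⁻¹) ^ p with hM
  have hM0 : 0 < M := by positivity
  refine ⟨2 ^ p * M, by positivity, fun x r R K N e hr hR hK hfar hN hN' he hdecay => ?_⟩
  have h := le_variationalCapacity (μ := μ) hp (E := ball x r) (Ω := ball x R) isOpen_ball
    (A := ENNReal.ofReal K⁻¹ / ENNReal.ofReal M) ?_
  · rw [ENNReal.div_le_iff (by simpa using hM0) ENNReal.ofReal_ne_top] at h
    refine h.trans (le_of_eq ?_)
    rw [ENNReal.ofReal_mul (by positivity), ← ENNReal.ofReal_rpow_of_pos two_pos,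
      ENNReal.ofReal_ofNat]
    ring
  · intro v G hvm hv0 hv1 hvr hvR hG hGp
    rw [ENNReal.div_le_iff (by simpa using hM0) ENNReal.ofReal_ne_top]
    have hsum := hP.inv_le_sum hC hμ hp0 hΛ hD hdouble hr hR hfar hvm hv0 hv1 hvr hvR hG hGp hN hN'
    have h1 := inv_le_rpow_mul_of_le_sum (B := D * C) (S := S)
      (s := fun j => 2 ^ (j + 1) * r) (m := fun j => μ.real (ball x (2 ^ (j + 1) * r))) (e := e)
      hp0 (by positivity) (by positivity) ENNReal.toReal_nonneg hK hθ (fun j => by positivity)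
      (fun j => ENNReal.toReal_pos (hμ x _ (by positivity)).1.ne' (hμ x _ (by positivity)).2.ne)
      -- By `he` the exponents may be put in their natural order, and the geometric series bounds
      -- the sum by S, uniformly in N.
      hdecay (by rw [he]; exact sum_range_pow_le hτ0.le hτ1 N)
      (hsum.trans_eq (Finset.sum_congr rfl fun j _ => by rw [mul_assoc D C]))
    calc ENNReal.ofReal K⁻¹ ≤ ENNReal.ofReal (M * (∫⁻ z, G z ^ p ∂μ).toReal) :=
          ENNReal.ofReal_le_ofReal h1
      _ = (∫⁻ z, G z ^ p ∂μ) * ENNReal.ofReal M := by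
        rw [ENNReal.ofReal_mul hM0.le, ENNReal.ofReal_toReal hGp.ne, mul_comm]

end CapacityEstimates

/-! ### Choice of scales, and proof of the theorem. -/

/-- If every point were within 2R₀ of x, the diameter would be at most 4R₀. This is the use of the
bound on R₀. -/
theorem exists_two_mul_le_dist {X : Type*} [MetricSpace X] {R₀ : ℝ} (hR₀ : 0 < R₀)
    (hdiam : ENNReal.ofReal R₀ < ediam (univ : Set X) / 4) (x : X) : ∃ y, 2 * R₀ ≤ dist y x := by
  by_contra! h
  refine hdiam.not_ge (ENNReal.div_le_of_le_mul (ediam_le fun a _ b _ => ?_))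
  rw [edist_dist, ← ENNReal.ofReal_ofNat 4, ← ENNReal.ofReal_mul hR₀.le]
  refine ENNReal.ofReal_le_ofReal ?_
  linarith [dist_triangle_right a b x, h a, h b]

theorem exists_dyadic_scale {r R : ℝ} (hr : 0 < r) (hrR : r ≤ R) :
    ∃ N : ℕ, 4 * R ≤ 2 ^ N * r ∧ 2 ^ N * r ≤ 8 * R := by
  obtain ⟨n, h1, h2⟩ := exists_nat_pow_near (x := 4 * R / r) (y := 2)
    (by rw [one_le_div hr]; linarith) one_lt_two
  rw [le_div_iff₀ hr] at h1
  rw [div_lt_iff₀ hr] at h2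
  exact ⟨n + 1, h2.le, by rw [pow_succ]; linarith⟩

theorem CapacityComparable.of_le_of_le {X : Type*} [MetricSpace X] [MeasurableSpace X]
    {μ : Measure X} {p : ℝ} {x : X} {R₀ : ℝ} {F : ℝ → ℝ → ℝ≥0∞} {a b : ℝ} (ha : 0 < a)
    (hb : 0 < b)
    (h1 : ∀ r R, 0 < r → 2 * r ≤ R → R ≤ R₀ →
      variationalCapacity p μ (ball x r) (ball x R) ≤ ENNReal.ofReal a * F r R)
    (h2 : ∀ r R, 0 < r → 2 * r ≤ R → R ≤ R₀ →
      F r R ≤ ENNReal.ofReal b * variationalCapacity p μ (ball x r) (ball x R)) :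
    CapacityComparable p μ x R₀ F := by
  refine ⟨a + b, by positivity, fun r R hr hrR hR => ⟨(h1 r R hr hrR hR).trans ?_,
    (h2 r R hr hrR hR).trans ?_⟩⟩ <;> gcongr <;> linarith

theorem measure_div_ofReal_rpow {α : Type*} [MeasurableSpace α] {μ : Measure α} {A : Set α}
    (hA : μ A ≠ ∞) {p s : ℝ} (hs : 0 < s) :
    μ A / ENNReal.ofReal (s ^ p) = ENNReal.ofReal (μ.real A / s ^ p) := by
  rw [ENNReal.ofReal_div_of_pos (by positivity), ofReal_measureReal hA]

theorem exists_gt_mem_of_mem_interior {S : Set ℝ} {a : ℝ} (h : a ∈ interior S) :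
    ∃ b ∈ S, a < b := by
  obtain ⟨ε, hε, hs⟩ := Metric.mem_nhds_iff.1 (mem_interior_iff_mem_nhds.1 h)
  exact ⟨a + ε / 2, hs (by rw [mem_ball, Real.dist_eq, add_sub_cancel_left, abs_of_pos] <;>
    linarith), by linarith⟩

theorem exists_lt_mem_of_mem_interior {S : Set ℝ} {a : ℝ} (h : a ∈ interior S) :
    ∃ b ∈ S, b < a := by
  obtain ⟨ε, hε, hs⟩ := Metric.mem_nhds_iff.1 (mem_interior_iff_mem_nhds.1 h)
  exact ⟨a - ε / 2, hs (by rw [mem_ball, Real.dist_eq, sub_sub_cancel_left, abs_neg, abs_of_pos] <;>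
    linarith), by linarith⟩

theorem theorem1p1 {X : Type*} [MetricSpace X] [MeasurableSpace X] [BorelSpace X]
    (μ : Measure X)
    (hμ : ∀ (y : X) (r : ℝ), 0 < r → 0 < μ (ball y r) ∧ μ (ball y r) < ∞)
    (p : ℝ) (hp : 1 ≤ p)
    (hdoubling : IsGloballyDoubling μ) (hpoincare : SupportsPoincare p μ)
    (x : X) (R₀ : ℝ) (hR₀ : 0 < R₀) (hdiam : ENNReal.ofReal R₀ < ediam (univ : Set X) / 4) :
    (p ∈ interior (lowerQZero μ x) →
      CapacityComparable p μ x R₀ (fun r _ => μ (ball x r) / ENNReal.ofReal (r ^ p))) ∧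
    (p ∈ interior (upperQZero μ x) →
      CapacityComparable p μ x R₀ (fun _ R => μ (ball x R) / ENNReal.ofReal (R ^ p))) ∧
    (CapacityComparable p μ x R₀ (fun r _ => μ (ball x r) / ENNReal.ofReal (r ^ p)) →
      p ∈ lowerQZero μ x) ∧
    (CapacityComparable p μ x R₀ (fun _ R => μ (ball x R) / ENNReal.ofReal (R ^ p)) →
      p ∈ upperQZero μ x) := by
  obtain ⟨D, hD, hdouble⟩ := hdoubling
  obtain ⟨C, Λ, hC, hΛ, hP⟩ := hpoincare
  have hPI : PoincareInequality p C Λ μ := hP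
  have hp0 : 0 < p := by linarith
  set m : ℝ → ℝ := fun r => μ.real (ball x r) with hm
  have hm0 : ∀ r, 0 < r → 0 < m r := fun r hr =>
    ENNReal.toReal_pos (hμ x r hr).1.ne' (hμ x r hr).2.ne
  have hmono : ∀ r s, 0 < r → r ≤ s → m r ≤ m s := fun r s hr hrs =>
    measureReal_mono (ball_subset_ball hrs) (hμ x s (hr.trans_le hrs)).2.ne
  have hmD : ∀ r, 0 < r → m (2 * r) ≤ D * m r := by
    intro r hr
    have := ENNReal.toReal_mono (ENNReal.mul_ne_top ENNReal.ofReal_ne_top (hμ x r hr).2.ne)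
      (hdouble x r hr)
    rwa [ENNReal.toReal_mul, ENNReal.toReal_ofReal hD.le] at this
  have hF : ∀ r, 0 < r → μ (ball x r) / ENNReal.ofReal (r ^ p) = ENNReal.ofReal (m r / r ^ p) :=
    fun r hr => measure_div_ofReal_rpow (hμ x r hr).2.ne hr
  have hfar : ∀ R, R ≤ R₀ → ∃ y, 2 * R ≤ dist y x := by
    intro R hR
    obtain ⟨y, hy⟩ := exists_two_mul_le_dist hR₀ hdiam x
    exact ⟨y, by linarith⟩
  have hup1 : ∀ r R, 0 < r → 2 * r ≤ R → R ≤ R₀ → variationalCapacity p μ (ball x r) (ball x R) ≤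
      ENNReal.ofReal D * (μ (ball x r) / ENNReal.ofReal (r ^ p)) := by
    intro r R hr hrR _
    refine (variationalCapacity_ball_le hμ hp x hr le_rfl hrR).trans ?_
    rw [← mul_div_assoc]
    exact ENNReal.div_le_div_right (hdouble x r hr) _
  have hup2 : ∀ r R, 0 < r → 2 * r ≤ R → R ≤ R₀ → variationalCapacity p μ (ball x r) (ball x R) ≤
      ENNReal.ofReal (2 ^ p) * (μ (ball x R) / ENNReal.ofReal (R ^ p)) := by
    intro r R hr hrR _
    have hR : 0 < R := by linarith
    have h := variationalCapacity_ball_le hμ hp x (r := r) (s := R / 2) (R := R) (by positivity)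
      (by linarith) (by linarith)
    rw [mul_div_cancel₀ R two_ne_zero, measure_div_ofReal_rpow (hμ x R hR).2.ne (by positivity)] at h
    rw [hF R hR, ← ENNReal.ofReal_mul (by positivity)]
    refine h.trans_eq ?_
    rw [Real.div_rpow hR.le zero_le_two]
    congr 1
    simp only [hm]
    field_simp
  refine ⟨fun hint => ?_, fun hint => ?_, fun ⟨K, hK, h⟩ => ?_, fun ⟨K, hK, h⟩ => ?_⟩
  · obtain ⟨q, ⟨hq, A, hA, hAq⟩, hpq⟩ := exists_gt_mem_of_mem_interior hint
    -- The dyadic radii reach up to 8R₀, possibly beyond the range R ≤ 1 in the definition.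
    obtain ⟨k, hk, hkq⟩ := div_le_mul_rpow_extend hm0 hmono hq hA one_pos hAq (8 * R₀)
    obtain ⟨M, hM, hcap⟩ := hPI.ofReal_inv_le_variationalCapacity hC hμ hp hΛ hD hdouble
      (θ := 2 ^ (p - q)) (by positivity) (Real.rpow_lt_one_of_one_lt_of_neg one_lt_two (by linarith))
    refine CapacityComparable.of_le_of_le hD (mul_pos hk hM) hup1 fun r R hr hrR hR => ?_
    obtain ⟨N, hN, hN'⟩ := exists_dyadic_scale hr (R := R) (by linarith)
    have hmr := hm0 r hr
    -- The smallest scale dominates: K is comparable to r^p/μ(B_r), and the exponent counts dyadic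
    -- steps upwards.
    have h := hcap x r R (k * r ^ p / m r) N (fun j => j) hr (by linarith) (by positivity)
      (hfar R hR) hN hN' (fun τ => rfl) fun j hj => ?_
    · rw [hF r hr, ENNReal.ofReal_mul hk.le, mul_assoc]
      refine le_trans (le_of_eq ?_) (mul_le_mul' le_rfl h)
      rw [← ENNReal.ofReal_mul hk.le]
      congr 1
      field_simp
    · set t : ℝ := 2 ^ (j + 1) with ht
      have ht1 : 1 ≤ t := one_le_pow₀ one_le_two
      have ht0 : 0 < t := by positivity
      have hms := hm0 (t * r) (by positivity)
      have htN : t ≤ 2 ^ N := pow_le_pow_right₀ one_le_two hj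
      have h1 := hkq r (t * r) hr (le_mul_of_one_le_left hr.le ht1)
        ((mul_le_mul_of_nonneg_right htN hr.le).trans (by linarith))
      have h2 : r / (t * r) = t⁻¹ := by field_simp
      rw [h2, Real.inv_rpow ht0.le] at h1
      calc (t * r) ^ p / m (t * r) = t ^ p * r ^ p / m r * (m r / m (t * r)) := by
            rw [Real.mul_rpow ht0.le hr.le]; field_simp
        _ ≤ t ^ p * r ^ p / m r * (k * (t ^ q)⁻¹) := by gcongr
        _ = k * r ^ p / m r * t ^ (p - q) := by rw [Real.rpow_sub ht0]; ring
        -- The true exponent is j + 1. Lowering it to j is harmless since 2^{p-q} < 1.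
        _ ≤ k * r ^ p / m r * (2 ^ (p - q)) ^ j := by
          gcongr
          rw [ht, ← Real.rpow_natCast, ← Real.rpow_natCast, ← Real.rpow_mul zero_le_two,
            ← Real.rpow_mul zero_le_two]
          refine Real.rpow_le_rpow_of_exponent_le one_le_two ?_
          push_cast
          nlinarith
  · obtain ⟨q, ⟨hq, A, hA, hAq⟩, hpq⟩ := exists_lt_mem_of_mem_interior hint
    obtain ⟨k, hk, hkq⟩ := mul_rpow_le_div_extend hm0 hmono hq hA one_pos hAq (8 * R₀)
    obtain ⟨M, hM, hcap⟩ := hPI.ofReal_inv_le_variationalCapacity hC hμ hp hΛ hD hdouble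
      (θ := 2 ^ (q - p)) (by positivity) (Real.rpow_lt_one_of_one_lt_of_neg one_lt_two (by linarith))
    refine CapacityComparable.of_le_of_le (a := 2 ^ p) (b := 8 ^ p / k * M) (by positivity)
      (by positivity) hup2 fun r R hr hrR hR => ?_
    have hR0 : 0 < R := by linarith
    obtain ⟨N, hN, hN'⟩ := exists_dyadic_scale hr (R := R) (by linarith)
    have hmR := hm0 R hR0
    -- The largest scale T = 2^N r dominates, and N - 1 - j counts the steps from 2^{j+1} r up to T.
    -- The factor 8^p comes from replacing T by R, using T ≤ 8R and μ(B_R) ≤ μ(B_T).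
    have h := hcap x r R (8 ^ p / k * R ^ p / m R) N (fun j => N - 1 - j) hr (by linarith)
      (by positivity) (hfar R hR) hN hN' (fun τ => Finset.sum_range_reflect (fun j => τ ^ j) N)
      fun j hj => ?_
    · rw [hF R hR0, ENNReal.ofReal_mul (by positivity), mul_assoc]
      refine le_trans (le_of_eq ?_) (mul_le_mul' le_rfl h)
      rw [← ENNReal.ofReal_mul (by positivity)]
      congr 1
      field_simp
    · set s : ℝ := 2 ^ (j + 1) * r with hs
      set T : ℝ := 2 ^ N * r with hT
      have hs0 : 0 < s := by positivity
      have hT0 : 0 < T := by positivity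
      have hms := hm0 s hs0
      have hmT := hm0 T hT0
      have hsT : s ≤ T := mul_le_mul_of_nonneg_right (pow_le_pow_right₀ one_le_two hj) hr.le
      have h1 := hkq s T hs0 hsT (by linarith)
      have hpow : (s / T) ^ (p - q) = (2 ^ (q - p)) ^ (N - 1 - j) := by
        have h2 : s / T = (2 ^ (N - 1 - j))⁻¹ := by
          have h3 : (2 : ℝ) ^ N = 2 ^ (N - 1 - j) * 2 ^ (j + 1) := by
            rw [← pow_add]; congr 1; omega
          rw [hs, hT, h3]
          field_simp
        rw [h2, Real.inv_rpow (by positivity), ← Real.rpow_neg (by positivity), neg_sub,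
          ← Real.rpow_natCast, ← Real.rpow_natCast, ← Real.rpow_mul zero_le_two,
          ← Real.rpow_mul zero_le_two, mul_comm]
      have h4 : s ^ p / m s ≤ k⁻¹ * T ^ p / m T * (s / T) ^ (p - q) := by
        rw [Real.rpow_sub (by positivity), Real.div_rpow hs0.le hT0.le p]
        have hpos : 0 < (s / T) ^ q := by positivity
        have e : k⁻¹ * T ^ p / m T * (s ^ p / T ^ p / (s / T) ^ q) =
            s ^ p / (k * (s / T) ^ q * m T) := by field_simp
        rw [e]
        refine div_le_div_of_nonneg_left (by positivity) (by positivity) ?_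
        rwa [le_div_iff₀ hmT] at h1
      refine h4.trans ?_
      rw [hpow]
      refine mul_le_mul_of_nonneg_right ?_ (by positivity)
      have h5 : T ^ p ≤ 8 ^ p * R ^ p := by
        rw [← Real.mul_rpow (by norm_num) hR0.le]
        exact Real.rpow_le_rpow hT0.le hN' hp0.le
      have h6 : m R ≤ m T := hmono R T hR0 (by linarith)
      calc k⁻¹ * T ^ p / m T ≤ k⁻¹ * (8 ^ p * R ^ p) / m R := by gcongr
        _ = _ := by ring
  -- The lower estimate in (1) meets the unconditional upper bound by μ(B_R)/R^p, and the capacity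
  -- cancels.
  · have hcomp : ∀ r R, 0 < r → 2 * r ≤ R → R ≤ R₀ →
        m r / m R ≤ K * 2 ^ p * (r / R) ^ p := by
      intro r R hr hrR hR
      have hR0 : 0 < R := by linarith
      have hmR := hm0 R hR0
      have h1 := (h r R hr hrR hR).2.trans (mul_le_mul' le_rfl (hup2 r R hr hrR hR))
      beta_reduce at h1
      rw [hF r hr, hF R hR0, ← ENNReal.ofReal_mul (by positivity), ← ENNReal.ofReal_mul hK.le,
        ENNReal.ofReal_le_ofReal_iff (by positivity), div_le_iff₀ (by positivity)] at h1
      rw [div_le_iff₀ hmR, Real.div_rpow hr.le hR0.le]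
      refine h1.trans_eq ?_
      ring
    -- For R < 2r the measure ratio is at most 1 and (2r/R)^p is at least 1.
    have hcomp' : ∀ r R, 0 < r → r < R → R ≤ R₀ →
        m r / m R ≤ (K + 1) * 2 ^ p * (r / R) ^ p := by
      intro r R hr hrR hR
      have hR0 : 0 < R := hr.trans hrR
      rcases le_or_gt (2 * r) R with h2 | h2
      · refine (hcomp r R hr h2 hR).trans ?_
        gcongr
        linarith
      · have h3 : m r / m R ≤ 1 := (div_le_one (hm0 R hR0)).2 (hmono r R hr hrR.le)
        have h4 : 1 ≤ 2 ^ p * (r / R) ^ p := by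
          rw [← Real.mul_rpow zero_le_two (by positivity)]
          refine Real.one_le_rpow ?_ hp0.le
          rw [← mul_div_assoc, one_le_div hR0]
          exact h2.le
        nlinarith
    obtain ⟨k, hk, hkq⟩ := div_le_mul_rpow_extend hm0 hmono hp0 (by positivity) hR₀ hcomp' 1
    exact ⟨hp0, k, hk, fun r R hr hrR hR => hkq r R hr hrR.le hR⟩
  -- Symmetrically, the lower estimate in (2) meets the unconditional upper bound by μ(B_r)/r^p.
  · have hcomp : ∀ r R, 0 < r → 2 * r ≤ R → R ≤ R₀ →
        (K * D)⁻¹ * (r / R) ^ p ≤ m r / m R := by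
      intro r R hr hrR hR
      have hR0 : 0 < R := by linarith
      have hmR := hm0 R hR0
      have hmr := hm0 r hr
      have h1 := (h r R hr hrR hR).2.trans (mul_le_mul' le_rfl (hup1 r R hr hrR hR))
      beta_reduce at h1
      rw [hF r hr, hF R hR0, ← ENNReal.ofReal_mul (by positivity), ← ENNReal.ofReal_mul hK.le,
        ENNReal.ofReal_le_ofReal_iff (by positivity), div_le_iff₀ (by positivity)] at h1
      rw [le_div_iff₀ hmR, mul_assoc, inv_mul_le_iff₀ (by positivity),
        Real.div_rpow hr.le hR0.le]
      refine (mul_le_mul_of_nonneg_left h1 (by positivity)).trans_eq ?_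
      field_simp
    have hcomp' : ∀ r R, 0 < r → r < R → R ≤ R₀ →
        (K * D + D)⁻¹ * (r / R) ^ p ≤ m r / m R := by
      intro r R hr hrR hR
      have hR0 : 0 < R := hr.trans hrR
      rcases le_or_gt (2 * r) R with h2 | h2
      · refine le_trans ?_ (hcomp r R hr h2 hR)
        gcongr
        linarith
      · have hmR := hm0 R hR0
        -- For R < 2r one doubling bounds the measure ratio from below.
        have h3 : D⁻¹ ≤ m r / m R := by
          rw [le_div_iff₀ hmR, inv_mul_le_iff₀ hD]
          exact (hmono R (2 * r) hR0 h2.le).trans (hmD r hr)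
        calc (K * D + D)⁻¹ * (r / R) ^ p ≤ D⁻¹ * 1 := by
              gcongr
              · linarith [mul_pos hK hD]
              · exact Real.rpow_le_one (by positivity) ((div_le_one hR0).2 hrR.le) hp0.le
          _ ≤ m r / m R := by rwa [mul_one]
    obtain ⟨k, hk, hkq⟩ := mul_rpow_le_div_extend hm0 hmono hp0 (by positivity) hR₀ hcomp' 1
    exact ⟨hp0, k, hk, fun r R hr hrR hR => hkq r R hr hrR.le hR⟩
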